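/- **Theorem (Unbounded formulation of the rotation group).** Work in the complex Hilbert space $L^2(\mathbb R^3)$ with coordinates $(r_1,r_2,r_3)=(x,y,z)$, and let all derivatives be taken in the sense of (tempered) distributions. An *infinitesimal generator* in $L^2(\mathbb R^3)$ is an operator $A$ for which there is a $C_0$-semigroup $(U(t))_{t\ge 0}$ of bounded operators on $L^2(\mathbb R^3)$ such that $u\in D(A)$ and $Au=v$ if and only if $\lim_{h\to 0+}h^{-1}(U(h)u-u)=v$ in $L^2(\mathbb R^3)$. Let $$H^1_r(\mathbb R^3)=\{u\in H^1(\mathbb R^3):\ r_i\,\partial_{r_j}u\in L^2(\mathbb R^3)\ \text{for all } i,j\in\{1,2,3\}\}.$$ 1. Let $i\ne j$. Each of the two operators $\pm r_i\partial_{r_j}$, with initial domain $H^1_r(\mathbb R^3)$, is closable, its closure is the operator $\pm r_i\partial_{r_j}$ with domain $\{u\in L^2(\mathbb R^3): r_i\partial_{r_j}u\in L^2(\mathbb R^3)\}$, and this closure is an infinitesimal generator in $L^2(\mathbb R^3)$. 2. Let $\hbar\neq 0$ be real and let $\mathcal L_x=-i\hbar(y\partial_z-z\partial_y)$, $\mathcal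 L_y=-i\hbar(z\partial_x-x\partial_z)$, $\mathcal L_z=-i\hbar(x\partial_y-y\partial_x)$ be the angular momentum operators, $\mathcal L_k$ having domain $\{u\in L^2(\mathbb R^3):\mathcal L_k u\in L^2(\mathbb R^3)\}$. Then $$\pm \tfrac{i}{\hbar}\mathcal L_x=\pm(y\partial_z-z\partial_y),\qquad \pm \tfrac{i}{\hbar}\mathcal L_y=\pm(z\partial_x-x\partial_z),\qquad \pm \tfrac{i}{\hbar}\mathcal L_z=\pm(x\partial_y-y\partial_x)$$ (equality of operators including their domains, each operator on the right having as domain the set of $u\in L^2(\mathbb R^3)$ that it maps into $L^2(\mathbb R^3)$), each of these six operators is an infinitesimal generator in $L^2(\mathbb R^3)$, and each of them is the closure of its restriction to $H^1_r(\mathbb R^3)$. -/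

import Mathlib

open MeasureTheory Filter Topology
open scoped SchwartzMap LineDeriv NNReal

noncomputable section

/-- The Euclidean space `ℝ³`; the coordinates `x, y, z` are the coordinates `0, 1, 2`. -/
abbrev R3 : Type := EuclideanSpace ℝ (Fin 3)

/-- The complex Hilbert space `L²(ℝ³)` with respect to Lebesgue measure. -/
abbrev L2R3 : Type := Lp ℂ 2 (volume : Measure R3)

/-! ### Strongly continuous semigroups and their infinitesimal generators -/

/-- `U` is a strongly continuous one-parameter semigroup (a `C₀`-semigroup) of bounded operators
on `X`. -/
structure IsC0Semigroup {X : Type*} [NormedAddCommGroup X] [NormedSpace ℂ X]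
    (U : ℝ≥0 → X →L[ℂ] X) : Prop where
  map_zero : U 0 = ContinuousLinearMap.id ℂ X
  map_add : ∀ s t : ℝ≥0, U (s + t) = (U s).comp (U t)
  continuous_orbit : ∀ u : X, Continuous fun t : ℝ≥0 => U t u

/-- `A` is an infinitesimal generator in `X`: for some `C₀`-semigroup `U`, the domain of `A` is
exactly the set of those `u` for which `lim_{h → 0+} h⁻¹ (U(h) u - u)` exists in `X`, and `A u` is
that limit. -/
def IsInfinitesimalGenerator {X : Type*} [NormedAddCommGroup X] [NormedSpace ℂ X]
    (A : X →ₗ.[ℂ] X) : Prop :=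
  ∃ U : ℝ≥0 → X →L[ℂ] X, IsC0Semigroup U ∧
    ∀ u v : X, (u, v) ∈ A.graph ↔
      Tendsto (fun h : ℝ≥0 => ((h : ℝ) : ℂ)⁻¹ • (U h u - u)) (𝓝[>] 0) (𝓝 v)

/-! ### Differential operators on tempered distributions and their realizations in `L²(ℝ³)` -/

/-- The inclusion of `L²(ℝ³)` into the tempered distributions. -/
def L2R3.toDistribution : L2R3 →ₗ[ℂ] 𝓢'(R3, ℂ) :=
  (Lp.toTemperedDistributionCLM ℂ (volume : Measure R3) 2).toLinearMap

theorem L2R3.toDistribution_injective : Function.Injective L2R3.toDistribution :=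
  LinearMap.ker_eq_bot.mp Lp.ker_toTemperedDistributionCLM_eq_bot

/-- The realization in `L²(ℝ³)` of an operator `D` from `L²(ℝ³)` to tempered distributions:
its domain is `{u ∈ L² : D u ∈ L²}`, and there it acts as `D`. -/
def realization (D : L2R3 →ₗ[ℂ] 𝓢'(R3, ℂ)) : L2R3 →ₗ.[ℂ] L2R3 where
  domain := (LinearMap.range L2R3.toDistribution).comap D
  toFun := (LinearEquiv.ofInjective L2R3.toDistribution
      L2R3.toDistribution_injective).symm.toLinearMap ∘ₗ
    D.restrict (p := (LinearMap.range L2R3.toDistribution).comap D)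
      (q := LinearMap.range L2R3.toDistribution) fun _ hu => hu

theorem mem_graph_realization_iff (D : L2R3 →ₗ[ℂ] 𝓢'(R3, ℂ)) (u v : L2R3) :
    (u, v) ∈ (realization D).graph ↔ D u = L2R3.toDistribution v := by
  rw [LinearPMap.mem_graph_iff]
  constructor
  · rintro ⟨y, rfl, rfl⟩
    have h := LinearEquiv.apply_symm_apply (LinearEquiv.ofInjective L2R3.toDistribution
      L2R3.toDistribution_injective) ⟨D y, y.2⟩
    exact (congrArg Subtype.val h).symm
  · intro h
    refine ⟨⟨u, ⟨v, h.symm⟩⟩, rfl, ?_⟩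
    apply L2R3.toDistribution_injective
    have h' := LinearEquiv.apply_symm_apply (LinearEquiv.ofInjective L2R3.toDistribution
      L2R3.toDistribution_injective) ⟨D u, ⟨v, h.symm⟩⟩
    exact (congrArg Subtype.val h').trans h

/-- The `i`-th coordinate function `r_i` on `ℝ³`, as a complex-valued function. -/
def coordFun (i : Fin 3) : R3 → ℂ := fun r => ((r i : ℝ) : ℂ)

theorem coordFun_hasTemperateGrowth (i : Fin 3) : (coordFun i).HasTemperateGrowth :=
  (Complex.ofRealCLM ∘L (EuclideanSpace.proj i : R3 →L[ℝ] ℝ)).hasTemperateGrowth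

/-- The partial derivative `∂_{r_j} u` of `u ∈ L²(ℝ³)`, as a tempered distribution. -/
def partialDist (j : Fin 3) : L2R3 →ₗ[ℂ] 𝓢'(R3, ℂ) :=
  (LineDeriv.lineDerivOpCLM ℂ 𝓢'(R3, ℂ) (EuclideanSpace.single j (1 : ℝ) : R3)).toLinearMap ∘ₗ
    L2R3.toDistribution

/-- The distribution `r_i ∂_{r_j} u` for `u ∈ L²(ℝ³)`. -/
def coordPartialDist (i j : Fin 3) : L2R3 →ₗ[ℂ] 𝓢'(R3, ℂ) :=
  (TemperedDistribution.smulLeftCLM ℂ (coordFun i)).toLinearMap ∘ₗ partialDist j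

/-- The operator `r_i ∂_{r_j}` in `L²(ℝ³)`, with domain `{u ∈ L² : r_i ∂_{r_j} u ∈ L²}`. -/
def coordPartial (i j : Fin 3) : L2R3 →ₗ.[ℂ] L2R3 :=
  realization (coordPartialDist i j)

/-- For `k = x, y, z` (that is `k = 0, 1, 2`) the distribution `(r × ∇)_k u`, which is
`y ∂_z u - z ∂_y u`, `z ∂_x u - x ∂_z u`, `x ∂_y u - y ∂_x u` respectively; the sums `k + 1` and
`k + 2` in `Fin 3` are cyclic. -/
def crossNablaDist (k : Fin 3) : L2R3 →ₗ[ℂ] 𝓢'(R3, ℂ) :=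
  coordPartialDist (k + 1) (k + 2) - coordPartialDist (k + 2) (k + 1)

/-- The operator `(r × ∇)_k` in `L²(ℝ³)`, with domain `{u ∈ L² : (r × ∇)_k u ∈ L²}`. -/
def crossNabla (k : Fin 3) : L2R3 →ₗ.[ℂ] L2R3 :=
  realization (crossNablaDist k)

/-- The component `𝓛_k = -iħ (r × ∇)_k` of the angular momentum operator in `L²(ℝ³)`. -/
def angularMomentum (ħ : ℝ) (k : Fin 3) : L2R3 →ₗ.[ℂ] L2R3 :=
  realization ((-(Complex.I * (ħ : ℂ))) • crossNablaDist k)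

/-- The weighted Sobolev space `H_r¹(ℝ³)` of those `u ∈ H¹(ℝ³)` for which every `r_i ∂_{r_j} u` is
in `L²(ℝ³)`. -/
def weightedH1 : Submodule ℂ L2R3 where
  carrier := {u | TemperedDistribution.MemSobolev 1 2 (L2R3.toDistribution u) ∧
    ∀ i j : Fin 3, u ∈ (coordPartial i j).domain}
  zero_mem' := by
    refine ⟨?_, fun i j => Submodule.zero_mem _⟩
    rw [map_zero]
    exact TemperedDistribution.memSobolev_fun_zero R3 ℂ 1 2
  add_mem' := by
    intro u v hu hv
    refine ⟨?_, fun i j => Submodule.add_mem _ (hu.2 i j) (hv.2 i j)⟩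
    rw [map_add]
    exact hu.1.add hv.1
  smul_mem' := by
    intro c u hu
    refine ⟨?_, fun i j => Submodule.smul_mem _ c (hu.2 i j)⟩
    rw [map_smul]
    exact hu.1.smul c

end

/-!
All operators of the theorem are derivatives `u ↦ (M r) · ∇ u` along a linear vector field `r ↦ M r`
on `ℝ³` of divergence zero: `M r = ± r_i e_j` for `± r_i ∂_{r_j}`, and an infinitesimal rotation for
`± (r × ∇)_k`. The flow `exp (t M)` consists of shears in the first case and of rotations in the
second, so it preserves Lebesgue measure and `U(t) u = u ∘ exp (t M)` is a strongly continuous group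
of isometries of `L²`. The theorem is proved for every such `M`.

*The generator of `U` is the maximal realization.* For a Schwartz function `φ`, the pairing
`∫ φ U(t) u = ∫ (φ ∘ exp (-t M)) u` may be differentiated under the integral sign
(`hasDerivAt_pairing_flowPullback`), and its derivative at `0` is the distribution `(M r) · ∇ u`
evaluated at `φ`. So a strong limit of the difference quotients is the distributional derivative.
Conversely, if the distribution `(M r) · ∇ u` is a function `v ∈ L²`, then integration of the
derivative of the pairing gives `U(h) u - u = ∫₀ʰ U(s) v ds` (`koopman_sub_eq_integral`), and the
right-hand side has derivative `v` at `h = 0`.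

*The Schwartz functions, hence all larger subspaces of the domain, form a core.* The operator `D` is
antisymmetric. If `(u, D u)` is orthogonal in `L² × L²` to the graph of `D` on Schwartz functions,
then `D (D u) = u`, so `u ± D u` are eigenvectors of `D` for the eigenvalues `± 1`. Their orbits
under `U` would grow exponentially in one time direction although `U` is isometric, so they vanish
(`eq_zero_of_apply_eq_real_smul`) and `u = 0`. As the graph of `D` is closed, it is the closure of
the graph over the Schwartz functions.
-/

/-! ### Linear vector fields and their flows -/

section LinearFlow

variable {E : Type*} [NormedAddCommGroup E] [NormedSpace ℝ E] (M : E →L[ℝ] E)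

/-- The derivative `r ↦ dφ(r)(M r)` of a Schwartz function `φ` along the linear vector field
`r ↦ M r`. -/
noncomputable def fieldDeriv (φ : 𝓢(E, ℂ)) : 𝓢(E, ℂ) :=
  SchwartzMap.bilinLeftCLM (ContinuousLinearMap.id ℝ (E →L[ℝ] ℂ)) M.hasTemperateGrowth
    (SchwartzMap.fderivCLM ℝ E ℂ φ)

@[simp]
theorem fieldDeriv_apply (φ : 𝓢(E, ℂ)) (r : E) : fieldDeriv M φ r = fderiv ℝ φ r (M r) := by
  simp [fieldDeriv]

variable [CompleteSpace E]

theorem exp_add_smul (s t : ℝ) :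
    NormedSpace.exp ((s + t) • M) = NormedSpace.exp (s • M) * NormedSpace.exp (t • M) := by
  let : NormedAlgebra ℚ (E →L[ℝ] E) := NormedAlgebra.restrictScalars ℚ ℝ _
  rw [add_smul, NormedSpace.exp_add_of_commute]
  exact ((Commute.refl M).smul_left s).smul_right t

/-- The flow `exp (t M)` of the linear vector field `r ↦ M r`. -/
noncomputable def flow (t : ℝ) : E ≃L[ℝ] E :=
  ContinuousLinearEquiv.equivOfInverse (NormedSpace.exp (t • M)) (NormedSpace.exp ((-t) • M))
    (fun r => by
      rw [← mul_apply_eq_comp, ← exp_add_smul]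
      simp)
    (fun r => by
      rw [← mul_apply_eq_comp, ← exp_add_smul]
      simp)

theorem flow_apply (t : ℝ) (r : E) : flow M t r = NormedSpace.exp (t • M) r := rfl

theorem flow_add (s t : ℝ) (r : E) : flow M (s + t) r = flow M s (flow M t r) := by
  simp only [flow_apply, exp_add_smul]
  rfl

@[simp]
theorem flow_zero (r : E) : flow M 0 r = r := by
  simp [flow_apply]

theorem flow_neg_flow (t : ℝ) (r : E) : flow M (-t) (flow M t r) = r := by
  rw [← flow_add]; simp

theorem continuous_flow : Continuous fun t : ℝ => (flow M t : E →L[ℝ] E) :=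
  continuous_iff_continuousAt.mpr fun t => (hasDerivAt_exp_smul_const M t).continuousAt

theorem hasDerivAt_flow (t : ℝ) (r : E) :
    HasDerivAt (fun s => flow M s r) (M (flow M t r)) t := by
  simpa using! (hasDerivAt_exp_smul_const' M t).clm_apply (hasDerivAt_const t r)

theorem map_flow (t : ℝ) (r : E) : M (flow M t r) = flow M t (M r) := by
  let : NormedAlgebra ℚ (E →L[ℝ] E) := NormedAlgebra.restrictScalars ℚ ℝ _
  have h : Commute M (NormedSpace.exp (t • M)) :=
    ((Commute.refl M).smul_right t).exp_right
  exact congrArg (fun L : E →L[ℝ] E => L r) h.eq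

/-- The pullback `φ ∘ exp (t M)` of a Schwartz function. -/
noncomputable def flowPullback (t : ℝ) (φ : 𝓢(E, ℂ)) : 𝓢(E, ℂ) :=
  SchwartzMap.compCLMOfContinuousLinearEquiv ℂ (flow M t) φ

@[simp]
theorem flowPullback_apply (t : ℝ) (φ : 𝓢(E, ℂ)) (r : E) :
    flowPullback M t φ r = φ (flow M t r) := rfl

/-- The derivative along a linear field commutes with the flow of the field. -/
theorem fieldDeriv_flowPullback (t : ℝ) (φ : 𝓢(E, ℂ)) :
    fieldDeriv M (flowPullback M t φ) = flowPullback M t (fieldDeriv M φ) := by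
  ext r
  have h : HasFDerivAt (flowPullback M t φ)
      ((fderiv ℝ φ (flow M t r)).comp (flow M t : E →L[ℝ] E)) r :=
    (φ.hasFDerivAt (flow M t r)).comp r (flow M t).hasFDerivAt
  simp [h.fderiv, map_flow]

end LinearFlow

/-! ### Pairing of `L²` with Schwartz functions -/

section Pairing

theorem toDistribution_apply (u : L2R3) (φ : 𝓢(R3, ℂ)) :
    L2R3.toDistribution u φ = ∫ r, φ r * u r := by
  simp [L2R3.toDistribution]

/-- The pairing `u ↦ ∫ φ u` with a fixed Schwartz function, as a continuous functional on `L²`. -/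
noncomputable def pairingCLM (φ : 𝓢(R3, ℂ)) : L2R3 →L[ℂ] ℂ where
  toFun u := L2R3.toDistribution u φ
  map_add' u v := by rw [map_add]; rfl
  map_smul' c u := by rw [map_smul]; rfl
  cont := (PointwiseConvergenceCLM.evalCLM (RingHom.id ℂ) ℂ φ).continuous.comp
    (Lp.toTemperedDistributionCLM ℂ (volume : Measure R3) 2).continuous

@[simp]
theorem pairingCLM_apply (φ : 𝓢(R3, ℂ)) (u : L2R3) :
    pairingCLM φ u = L2R3.toDistribution u φ := rfl

theorem L2R3.ext_pairing {u v : L2R3}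
    (h : ∀ φ : 𝓢(R3, ℂ), L2R3.toDistribution u φ = L2R3.toDistribution v φ) : u = v :=
  L2R3.toDistribution_injective (by ext φ; exact h φ)

theorem memLp_two_one_add_norm_rpow :
    MemLp (fun r : R3 => (1 + ‖r‖) ^ (-2 : ℝ)) 2 volume := by
  rw [memLp_two_iff_integrable_sq]
  · have h := integrable_one_add_norm (E := R3) (μ := volume) (r := 4) (by simp; norm_num)
    refine h.congr (.of_forall fun r => ?_)
    have : (0 : ℝ) ≤ 1 + ‖r‖ := by positivity
    simp only
    rw [← Real.rpow_natCast, ← Real.rpow_mul this]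
    norm_num
  · exact (Continuous.rpow_const (by fun_prop) fun r => Or.inl (by positivity)).aestronglyMeasurable

theorem exists_norm_le_one_add_norm_rpow (ψ : 𝓢(R3, ℂ)) :
    ∃ C : ℝ, 0 ≤ C ∧ ∀ r, ‖ψ r‖ ≤ C * (1 + ‖r‖) ^ (-2 : ℝ) := by
  refine ⟨2 ^ 2 * (Finset.Iic (2, 0)).sup (fun m => SchwartzMap.seminorm ℝ m.1 m.2) ψ,
    by positivity, fun r => ?_⟩
  have h := SchwartzMap.one_add_le_sup_seminorm_apply (𝕜 := ℝ) (m := (2, 0)) (k := 2) (n := 0)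
    le_rfl le_rfl ψ r
  have hr : (0 : ℝ) < 1 + ‖r‖ := by positivity
  rw [Real.rpow_neg hr.le, ← div_eq_mul_inv, le_div_iff₀ (by positivity), mul_comm]
  simpa using h

/-- Differentiation of `t ↦ ∫ (φ ∘ exp (t M)) u` under the integral sign. The decay of Schwartz
functions, uniform over the flow for bounded times, provides the dominating function. -/
theorem hasDerivAt_pairing_flowPullback (M : R3 →L[ℝ] R3) (u : L2R3) (φ : 𝓢(R3, ℂ)) (t : ℝ) :
    HasDerivAt (fun s => L2R3.toDistribution u (flowPullback M s φ))
      (L2R3.toDistribution u (flowPullback M t (fieldDeriv M φ))) t := by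
  simp only [toDistribution_apply]
  obtain ⟨C, hC0, hC⟩ := exists_norm_le_one_add_norm_rpow (fieldDeriv M φ)
  -- `K` bounds the backward flow near time `t`, so `1 + ‖r‖ ≤ K (1 + ‖exp (s M) r‖)` there.
  set K : ℝ := ‖(flow M (-t) : R3 →L[ℝ] R3)‖ + 1 with hK
  have hK1 : 1 ≤ K := by simp [hK]
  have hnear : ∀ᶠ s : ℝ in 𝓝 t, ‖(flow M (-s) : R3 →L[ℝ] R3)‖ < K := by
    have hc : Continuous fun s : ℝ => ‖(flow M (-s) : R3 →L[ℝ] R3)‖ :=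
      ((continuous_flow M).comp continuous_neg).norm
    exact hc.continuousAt.eventually_lt_const (by simp [hK])
  have hu := Lp.memLp u
  refine (hasDerivAt_integral_of_dominated_loc_of_deriv_le
    (F := fun s r => flowPullback M s φ r * u r)
    (F' := fun s r => flowPullback M s (fieldDeriv M φ) r * u r)
    (bound := fun r => (C * K ^ 2) * ((1 + ‖r‖) ^ (-2 : ℝ) * ‖u r‖))
    hnear ?_ ?_ ?_ ?_ ?_ ?_).2
  · exact .of_forall fun s =>
      (SchwartzMap.continuous _).aestronglyMeasurable.mul hu.aestronglyMeasurable
  · exact ((flowPullback M t φ).memLp 2).integrable_mul hu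
  · exact (SchwartzMap.continuous _).aestronglyMeasurable.mul hu.aestronglyMeasurable
  · refine .of_forall fun r s hs => ?_
    have hs' : ‖(flow M (-s) : R3 →L[ℝ] R3)‖ < K := hs
    have hr : 1 + ‖r‖ ≤ K * (1 + ‖flow M s r‖) := by
      have h1 : ‖r‖ ≤ K * ‖flow M s r‖ := by
        calc ‖r‖ = ‖flow M (-s) (flow M s r)‖ := by rw [flow_neg_flow]
          _ ≤ ‖(flow M (-s) : R3 →L[ℝ] R3)‖ * ‖flow M s r‖ :=
            ContinuousLinearMap.le_opNorm _ _
          _ ≤ K * ‖flow M s r‖ := by gcongr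
      linarith
    have hr0 : 0 < 1 + ‖r‖ := by positivity
    have hf0 : 0 < 1 + ‖flow M s r‖ := by positivity
    rw [norm_mul, ← mul_assoc]
    refine mul_le_mul_of_nonneg_right ((hC _).trans ?_) (norm_nonneg _)
    rw [mul_assoc]
    refine mul_le_mul_of_nonneg_left ?_ hC0
    change (1 + ‖flow M s r‖) ^ (-2 : ℝ) ≤ _
    rw [Real.rpow_neg hf0.le, Real.rpow_neg hr0.le, ← div_eq_mul_inv, le_div_iff₀ (by positivity),
      ← div_eq_inv_mul, div_le_iff₀ (by positivity)]
    calc (1 + ‖r‖) ^ (2 : ℝ) ≤ (K * (1 + ‖flow M s r‖)) ^ (2 : ℝ) := by gcongr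
      _ = K ^ 2 * (1 + ‖flow M s r‖) ^ (2 : ℝ) := by
        simp only [Real.rpow_ofNat]; ring
  · exact (memLp_two_one_add_norm_rpow.integrable_mul hu.norm).const_mul _
  · refine .of_forall fun r s _ => ?_
    have h := ((φ.hasFDerivAt (flow M s r)).comp_hasDerivAt s (hasDerivAt_flow M s r)).mul_const
      (u r)
    simpa using! h

end Pairing

/-! ### The group of a volume preserving linear flow and its generator -/

section Transport

/-- `D` is the operator `u ↦ (M r) · ∇ u` for a linear vector field `r ↦ M r` of divergence zero:
on distributions it is minus the transpose of `fieldDeriv M`, and on Schwartz functions it agrees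
with `fieldDeriv M`. -/
structure IsLinearTransport (D : L2R3 →ₗ[ℂ] 𝓢'(R3, ℂ)) (M : R3 →L[ℝ] R3) : Prop where
  apply : ∀ u φ, D u φ = -L2R3.toDistribution u (fieldDeriv M φ)
  toLp : ∀ φ : 𝓢(R3, ℂ), D (φ.toLp 2) = L2R3.toDistribution ((fieldDeriv M φ).toLp 2)

variable {M : R3 →L[ℝ] R3}

/-- The isometry `u ↦ u ∘ exp (t M)` of `L²` induced by a volume preserving linear flow. -/
noncomputable def koopman (hM : ∀ t, MeasurePreserving (flow M t)) (t : ℝ) :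
    L2R3 →ₗᵢ[ℂ] L2R3 :=
  Lp.compMeasurePreservingₗᵢ ℂ (flow M t) (hM t)

variable (hM : ∀ t, MeasurePreserving (flow M t))

theorem coeFn_koopman (t : ℝ) (u : L2R3) : koopman hM t u =ᵐ[volume] u ∘ flow M t :=
  Lp.coeFn_compMeasurePreserving u (hM t)

theorem toDistribution_koopman (t : ℝ) (u : L2R3) (φ : 𝓢(R3, ℂ)) :
    L2R3.toDistribution (koopman hM t u) φ =
      L2R3.toDistribution u (flowPullback M (-t) φ) := by
  simp only [toDistribution_apply]
  symm
  rw [← (hM t).integral_comp (flow M t).toHomeomorph.measurableEmbedding]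
  refine integral_congr_ae ?_
  filter_upwards [coeFn_koopman hM t u] with r hr
  rw [hr, flowPullback_apply, flow_neg_flow]
  rfl

@[simp]
theorem koopman_zero (u : L2R3) : koopman hM 0 u = u :=
  L2R3.ext_pairing fun φ => by
    rw [toDistribution_koopman]
    congr 1
    ext r
    simp

theorem koopman_add (s t : ℝ) (u : L2R3) :
    koopman hM (s + t) u = koopman hM s (koopman hM t u) :=
  L2R3.ext_pairing fun φ => by
    simp only [toDistribution_koopman]
    congr 1
    ext r
    simp only [flowPullback_apply, ← flow_add]
    congr 3
    ring

theorem continuous_koopman (u : L2R3) : Continuous fun t => koopman hM t u := by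
  have hg : Continuous fun t : ℝ => (⟨flow M t, (flow M t).continuous⟩ : C(R3, R3)) := by
    refine ContinuousMap.continuous_of_continuous_uncurry _ ?_
    change Continuous fun p : ℝ × R3 => (flow M p.1 : R3 →L[ℝ] R3) p.2
    exact ((continuous_flow M).comp continuous_fst).clm_apply continuous_snd
  exact Continuous.compMeasurePreservingLp (continuous_const (y := u)) hg hM (by simp)

variable {D : L2R3 →ₗ[ℂ] 𝓢'(R3, ℂ)}

theorem hasDerivAt_pairing_koopman (hD : IsLinearTransport D M) (u : L2R3) (φ : 𝓢(R3, ℂ))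
    (t : ℝ) :
    HasDerivAt (fun s => L2R3.toDistribution (koopman hM s u) φ)
      (D u (flowPullback M (-t) φ)) t := by
  simp only [toDistribution_koopman]
  rw [hD.apply, fieldDeriv_flowPullback]
  simpa using! (hasDerivAt_pairing_flowPullback M u φ (-t)).scomp t (hasDerivAt_neg t)

/-- If `D u = v` in the sense of distributions, then `t ↦ u ∘ exp (t M)` is an integral curve. It
is enough to pair both sides with Schwartz functions, where the fundamental theorem of calculus
applies. -/
theorem koopman_sub_eq_integral (hD : IsLinearTransport D M) {u v : L2R3}
    (huv : D u = L2R3.toDistribution v) (h : ℝ) :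
    koopman hM h u - u = ∫ s in (0 : ℝ)..h, koopman hM s v := by
  refine L2R3.ext_pairing fun φ => ?_
  have hc := continuous_koopman hM v
  rw [← pairingCLM_apply, ← pairingCLM_apply, map_sub,
    ← (pairingCLM φ).intervalIntegral_comp_comm (hc.intervalIntegrable _ _)]
  rw [intervalIntegral.integral_eq_sub_of_hasDerivAt
    (f := fun s => pairingCLM φ (koopman hM s u)) (f' := fun s => pairingCLM φ (koopman hM s v))
    (fun s _ => ?_) (((pairingCLM φ).continuous.comp hc).intervalIntegrable _ _)]
  · simp
  · have := hasDerivAt_pairing_koopman hM hD u φ s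
    rw [huv, ← toDistribution_koopman hM] at this
    exact this

theorem hasDerivAt_koopman_zero (hD : IsLinearTransport D M) {u v : L2R3}
    (huv : D u = L2R3.toDistribution v) : HasDerivAt (fun t => koopman hM t u) v 0 := by
  have h := ((continuous_koopman hM v).integral_hasStrictDerivAt 0 0).hasDerivAt.add_const u
  simp only [koopman_zero] at h
  refine h.congr_of_eventuallyEq (.of_forall fun t => ?_)
  simp [← koopman_sub_eq_integral hM hD huv]

theorem HasDerivAt.tendsto_nnreal_slope_zero {X : Type*} [NormedAddCommGroup X] [NormedSpace ℂ X]
    {f : ℝ → X} {f' : X} (hf : HasDerivAt f f' 0) :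
    Tendsto (fun h : ℝ≥0 => ((h : ℝ) : ℂ)⁻¹ • (f h - f 0)) (𝓝[>] 0) (𝓝 f') := by
  have hcoe : Tendsto (fun h : ℝ≥0 => (h : ℝ)) (𝓝[>] 0) (𝓝[>] 0) := by
    refine tendsto_nhdsWithin_iff.mpr ⟨?_, ?_⟩
    · exact (NNReal.continuous_coe.tendsto 0).mono_left nhdsWithin_le_nhds
    · filter_upwards [self_mem_nhdsWithin] with h hh
      exact NNReal.coe_pos.mpr hh
  refine (hf.tendsto_slope_zero_right.comp hcoe).congr fun h => ?_
  rw [← Complex.ofReal_inv, Complex.coe_smul]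
  simp

theorem isC0Semigroup_koopman :
    IsC0Semigroup fun t : ℝ≥0 => (koopman hM t).toContinuousLinearMap where
  map_zero := by ext1 u; simp
  map_add s t := by ext1 u; simpa using koopman_add hM s t u
  continuous_orbit u := (continuous_koopman hM u).comp NNReal.continuous_coe

/-- The generator of the semigroup `u ↦ u ∘ exp (t M)` is the maximal realization of
`(M r) · ∇`. -/
theorem isInfinitesimalGenerator_realization (hM : ∀ t, MeasurePreserving (flow M t))
    (hD : IsLinearTransport D M) : IsInfinitesimalGenerator (realization D) := by
  refine ⟨_, isC0Semigroup_koopman hM, fun u v => ?_⟩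
  rw [mem_graph_realization_iff]
  constructor
  · intro huv
    simpa using (hasDerivAt_koopman_zero hM hD huv).tendsto_nnreal_slope_zero
  · intro hlim
    ext φ
    have h₁ := (hasDerivAt_pairing_koopman hM hD u φ 0).tendsto_nnreal_slope_zero
    have h₂ := ((pairingCLM φ).continuous.tendsto v).comp hlim
    have h₃ : flowPullback M (-0) φ = φ := by ext r; simp
    rw [h₃] at h₁
    refine tendsto_nhds_unique (h₁.congr fun h => ?_) h₂
    simp

/-- A volume preserving flow has no eigenfunctions with real nonzero eigenvalue: the orbit would
grow exponentially in one time direction, but the flow acts by isometries. -/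
theorem eq_zero_of_apply_eq_real_smul (hM : ∀ t, MeasurePreserving (flow M t))
    (hD : IsLinearTransport D M) {w : L2R3} {c : ℝ}
    (hc : c ≠ 0) (hw : D w = L2R3.toDistribution ((c : ℂ) • w)) : w = 0 := by
  refine L2R3.ext_pairing fun φ => ?_
  set f : ℝ → ℂ := fun t => pairingCLM φ (koopman hM t w) with hf
  have hf' : ∀ t, HasDerivAt f (c * f t) t := fun t => by
    have := hasDerivAt_pairing_koopman hM hD w φ t
    rw [hw, ← toDistribution_koopman hM, map_smul, map_smul] at this
    exact this
  have hg : ∀ t : ℝ, HasDerivAt (fun t : ℝ => Complex.exp (-(c * t)) * f t) 0 t := fun t => by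
    have h₁ : HasDerivAt (fun t : ℝ => Complex.exp (-((c : ℂ) * t)))
        (Complex.exp (-(c * t)) * -(c * 1)) t :=
      ((Complex.ofRealCLM.hasDerivAt (x := t)).const_mul (c : ℂ)).neg.cexp
    convert! h₁.mul (hf' t) using 1
    ring
  have hconst : ∀ t : ℝ, Complex.exp (-(c * t)) * f t = f 0 := fun t => by
    have := is_const_of_deriv_eq_zero (fun t => (hg t).differentiableAt) (fun t => (hg t).deriv) t 0
    simpa using this
  have hbound : ∀ τ : ℝ, ‖f 0‖ ≤ Real.exp (-τ) * (‖pairingCLM φ‖ * ‖w‖) := fun τ => by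
    -- At time `τ / c` the orbit is `exp τ` times its initial value.
    rw [← hconst (τ / c), norm_mul]
    have h₁ : ‖Complex.exp (-(c * ((τ / c : ℝ) : ℂ)))‖ = Real.exp (-τ) := by
      rw [Complex.norm_exp, ← Complex.ofReal_mul, ← Complex.ofReal_neg, Complex.ofReal_re,
        mul_div_cancel₀ _ hc]
    rw [h₁]
    gcongr
    refine ((pairingCLM φ).le_opNorm _).trans_eq ?_
    rw [LinearIsometry.norm_map]
  have hlim : Tendsto (fun τ : ℝ => Real.exp (-τ) * (‖pairingCLM φ‖ * ‖w‖)) atTop (𝓝 0) := by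
    simpa using (Real.tendsto_exp_neg_atTop_nhds_zero).mul_const (‖pairingCLM φ‖ * ‖w‖)
  have h₀ : f 0 = 0 := norm_le_zero_iff.mp (ge_of_tendsto' hlim hbound)
  simpa [hf] using h₀

end Transport

/-! ### Cores -/

section Core

/-- The complex conjugate of a Schwartz function. -/
noncomputable def conjSchwartz (φ : 𝓢(R3, ℂ)) : 𝓢(R3, ℂ) :=
  SchwartzMap.postcompCLM (𝕜 := ℝ) (Complex.conjCLE : ℂ →L[ℝ] ℂ) φ

@[simp]
theorem conjSchwartz_apply (φ : 𝓢(R3, ℂ)) (r : R3) :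
    conjSchwartz φ r = starRingEnd ℂ (φ r) := rfl

theorem conjSchwartz_conjSchwartz (φ : 𝓢(R3, ℂ)) : conjSchwartz (conjSchwartz φ) = φ := by
  ext r; simp

theorem fieldDeriv_conjSchwartz (M : R3 →L[ℝ] R3) (φ : 𝓢(R3, ℂ)) :
    fieldDeriv M (conjSchwartz φ) = conjSchwartz (fieldDeriv M φ) := by
  ext r
  have h : HasFDerivAt (conjSchwartz φ)
      ((Complex.conjCLE : ℂ →L[ℝ] ℂ).comp (fderiv ℝ φ r)) r :=
    (Complex.conjCLE : ℂ →L[ℝ] ℂ).hasFDerivAt.comp r (φ.hasFDerivAt r)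
  simp [h.fderiv]

theorem inner_toLp_eq (φ : 𝓢(R3, ℂ)) (u : L2R3) :
    inner ℂ (φ.toLp 2 : L2R3) u = L2R3.toDistribution u (conjSchwartz φ) := by
  rw [L2.inner_def, toDistribution_apply]
  refine integral_congr_ae ?_
  filter_upwards [φ.coeFn_toLp 2 volume] with r hr
  rw [hr, RCLike.inner_apply, conjSchwartz_apply, mul_comm]

/-- A closed subspace `K` of a product of Hilbert spaces contains the subspace `G ≥ K` as soon as
`G` has no nonzero vector orthogonal to `K` in the Hilbert product. -/
theorem Submodule.le_of_prod_orthogonal {E F : Type*} [NormedAddCommGroup E]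
    [InnerProductSpace ℂ E] [CompleteSpace E] [NormedAddCommGroup F] [InnerProductSpace ℂ F]
    [CompleteSpace F] {K G : Submodule ℂ (E × F)} (hK : IsClosed (K : Set (E × F))) (hKG : K ≤ G)
    (h : ∀ x ∈ G, (∀ y ∈ K, inner ℂ y.1 x.1 + inner ℂ y.2 x.2 = 0) → x = 0) : G ≤ K := by
  set e := WithLp.prodContinuousLinearEquiv 2 ℂ E F with he
  set K' : Submodule ℂ (WithLp 2 (E × F)) := K.comap e.toLinearMap with hK'
  have hclosed : IsClosed (K' : Set (WithLp 2 (E × F))) := hK.preimage e.continuous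
  have : CompleteSpace K' := hclosed.completeSpace_coe
  intro x hx
  -- Project onto the closed subspace of the Hilbert product that corresponds to `K`.
  obtain ⟨y, hy, z, hz, hxyz⟩ := K'.exists_add_mem_mem_orthogonal (e.symm x)
  have hxyz' : x = e y + e z := by rw [← map_add, ← hxyz, e.apply_symm_apply]
  have hyK : e y ∈ K := hy
  have hz0 : e z = 0 := by
    refine h _ ?_ fun k hk => ?_
    · rw [← sub_eq_of_eq_add' hxyz']
      exact G.sub_mem hx (hKG hyK)
    · have hk' : e.symm k ∈ K' := by
        change e (e.symm k) ∈ K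
        rwa [e.apply_symm_apply]
      simpa [WithLp.prod_inner_apply] using! (Submodule.mem_orthogonal _ _).mp hz _ hk'
  rw [hxyz', hz0, add_zero]
  exact hyK

variable {M : R3 →L[ℝ] R3} {D : L2R3 →ₗ[ℂ] 𝓢'(R3, ℂ)}

/-- A vector `(u, v)` of the graph of `D` orthogonal to all `(φ, D φ)`, `φ` Schwartz, vanishes:
orthogonality says `D v = u`, so that `u + v` and `u - v` are eigenvectors of `D` for the
eigenvalues `1` and `-1`. -/
theorem eq_zero_of_orthogonal_graph_schwartz (hM : ∀ t, MeasurePreserving (flow M t))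
    (hD : IsLinearTransport D M) {u v : L2R3} (huv : D u = L2R3.toDistribution v)
    (horth : ∀ φ : 𝓢(R3, ℂ), inner ℂ (φ.toLp 2 : L2R3) u +
      inner ℂ ((fieldDeriv M φ).toLp 2 : L2R3) v = 0) : u = 0 ∧ v = 0 := by
  have hvu : D v = L2R3.toDistribution u := by
    ext φ
    have h := horth (conjSchwartz φ)
    rw [inner_toLp_eq, inner_toLp_eq, ← fieldDeriv_conjSchwartz, conjSchwartz_conjSchwartz] at h
    rw [hD.apply]
    exact (eq_neg_of_add_eq_zero_left h).symm
  have hadd : u + v = 0 := by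
    refine eq_zero_of_apply_eq_real_smul hM hD (c := 1) one_ne_zero ?_
    simp [huv, hvu, add_comm]
  have hsub : u - v = 0 := by
    refine eq_zero_of_apply_eq_real_smul hM hD (c := -1) (by norm_num) ?_
    simp [huv, hvu]
  have hu : u = v := sub_eq_zero.mp hsub
  subst hu
  have : (2 : ℂ) • u = 0 := by rw [two_smul, hadd]
  simpa using this

theorem isClosed_realization (hD : IsLinearTransport D M) : (realization D).IsClosed := by
  have h : ((realization D).graph : Set (L2R3 × L2R3)) =
      ⋂ φ : 𝓢(R3, ℂ), {p | -pairingCLM (fieldDeriv M φ) p.1 = pairingCLM φ p.2} := by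
    ext ⟨u, v⟩
    rw [SetLike.mem_coe, mem_graph_realization_iff, Set.mem_iInter]
    simp only [Set.mem_ofPred_eq, pairingCLM_apply, ← hD.apply]
    exact ⟨fun h φ => by rw [h], fun h => by ext φ; exact h φ⟩
  rw [LinearPMap.IsClosed, h]
  exact isClosed_iInter fun φ => isClosed_eq
    ((pairingCLM _).continuous.comp continuous_fst).neg
    ((pairingCLM φ).continuous.comp continuous_snd)

/-- Every subspace of the domain that contains the Schwartz functions is a core. -/
theorem hasCore_realization (hM : ∀ t, MeasurePreserving (flow M t)) (hD : IsLinearTransport D M)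
    {S : Submodule ℂ L2R3} (hS : S ≤ (realization D).domain)
    (hφ : ∀ φ : 𝓢(R3, ℂ), (φ.toLp 2 : L2R3) ∈ S) : (realization D).HasCore S := by
  refine ⟨hS, LinearPMap.eq_of_eq_graph ?_⟩
  have hcl := isClosed_realization hD
  have hle : (realization D).domRestrict S ≤ realization D := LinearPMap.domRestrict_le
  rw [← (hcl.isClosable.leIsClosable hle).graph_closure_eq_closure_graph]
  have hle' : ((realization D).domRestrict S).graph.topologicalClosure ≤ (realization D).graph :=
    Submodule.topologicalClosure_minimal _ (LinearPMap.le_graph_of_le hle) hcl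
  refine le_antisymm hle' (Submodule.le_of_prod_orthogonal
    (Submodule.isClosed_topologicalClosure _) hle' ?_)
  rintro ⟨u, v⟩ huv horth
  rw [mem_graph_realization_iff] at huv
  have := eq_zero_of_orthogonal_graph_schwartz hM hD huv fun φ =>
    horth (φ.toLp 2, (fieldDeriv M φ).toLp 2) (Submodule.le_topologicalClosure _ ?_)
  · exact Prod.ext this.1 this.2
  · have hmem : ((φ.toLp 2 : L2R3), ((fieldDeriv M φ).toLp 2 : L2R3)) ∈ (realization D).graph :=
      (mem_graph_realization_iff D _ _).mpr (hD.toLp φ)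
    obtain ⟨y, hy, hy'⟩ := (LinearPMap.mem_graph_iff _).mp hmem
    refine (LinearPMap.mem_graph_iff _).mpr ⟨⟨φ.toLp 2, hφ φ, hS (hφ φ)⟩, rfl, ?_⟩
    rw [← hy']
    exact LinearPMap.domRestrict_apply hy.symm

end Core

/-! ### Shears and rotations -/

section VolumePreserving

theorem exp_eq_one_add_of_mul_self_eq_zero {E : Type*} [NormedAddCommGroup E] [NormedSpace ℝ E]
    {N : E →L[ℝ] E} (h : N * N = 0) : NormedSpace.exp N = 1 + N := by
  rw [NormedSpace.exp_eq_tsum ℝ]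
  simp only
  rw [tsum_eq_sum (s := Finset.range 2)]
  · simp [Finset.sum_range_succ]
  · intro n hn
    obtain ⟨k, rfl⟩ : ∃ k, n = 2 + k :=
      Nat.exists_eq_add_of_le (by simpa [Nat.succ_le_iff] using hn)
    rw [pow_add, pow_two, h, zero_mul, smul_zero]

theorem flow_smul {E : Type*} [NormedAddCommGroup E] [NormedSpace ℝ E] [CompleteSpace E]
    (M : E →L[ℝ] E) (s t : ℝ) : flow (s • M) t = flow M (t * s) := by
  ext r
  rw [flow_apply, flow_apply, smul_smul]

/-- The flow of an infinitesimal rotation consists of isometries. -/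
theorem norm_flow_of_inner_eq_zero {E : Type*} [NormedAddCommGroup E] [InnerProductSpace ℝ E]
    [CompleteSpace E] {M : E →L[ℝ] E} (h : ∀ r, inner ℝ r (M r) = 0) (t : ℝ) (r : E) :
    ‖flow M t r‖ = ‖r‖ := by
  have hd : ∀ s, HasDerivAt (fun s => ‖flow M s r‖ ^ 2) 0 s := fun s => by
    simpa [h] using (hasDerivAt_flow M s r).norm_sq
  have := is_const_of_deriv_eq_zero (fun s => (hd s).differentiableAt) (fun s => (hd s).deriv) t 0
  simpa using this

theorem measurePreserving_flow_of_inner_eq_zero {M : R3 →L[ℝ] R3}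
    (h : ∀ r, inner ℝ r (M r) = 0) (t : ℝ) : MeasurePreserving (flow M t) :=
  (⟨(flow M t).toLinearEquiv, norm_flow_of_inner_eq_zero h t⟩ : R3 ≃ₗᵢ[ℝ] R3).measurePreserving

theorem measurePreserving_flow_smul {M : R3 →L[ℝ] R3} (hM : ∀ t, MeasurePreserving (flow M t))
    (s t : ℝ) : MeasurePreserving (flow (s • M) t) := by
  have h : flow (s • M) t = flow M (t * s) := flow_smul M s t
  rw [h]
  exact hM _

/-- The linear vector field `r_i e_j`. -/
noncomputable def coordField (i j : Fin 3) : R3 →L[ℝ] R3 :=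
  (EuclideanSpace.proj i : R3 →L[ℝ] ℝ).smulRight (EuclideanSpace.single j (1 : ℝ) : R3)

theorem coordField_apply (i j : Fin 3) (r : R3) :
    coordField i j r = r i • (EuclideanSpace.single j (1 : ℝ) : R3) := rfl

theorem flow_coordField {i j : Fin 3} (hij : i ≠ j) (t : ℝ) (r : R3) :
    flow (coordField i j) t r = r + (t * r i) • (EuclideanSpace.single j (1 : ℝ) : R3) := by
  have h : (t • coordField i j) * (t • coordField i j) = 0 := by
    ext r
    simp [coordField_apply, hij]
  rw [flow_apply, exp_eq_one_add_of_mul_self_eq_zero h]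
  simp [coordField_apply, smul_smul]

/-- The flow of the field `r_i e_j`, `i ≠ j`, consists of shears, which have determinant one. -/
theorem measurePreserving_flow_coordField {i j : Fin 3} (hij : i ≠ j) (t : ℝ) :
    MeasurePreserving (flow (coordField i j) t) := by
  set f : R3 →ₗ[ℝ] R3 := LinearMap.transvection (EuclideanSpace.proj i : R3 →L[ℝ] ℝ).toLinearMap
    (t • (EuclideanSpace.single j (1 : ℝ) : R3)) with hf
  have hdet : LinearMap.det f = 1 := by
    rw [hf, LinearMap.transvection.det]
    simp [hij]
  have hcoe : ⇑(flow (coordField i j) t) = f := by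
    ext1 r
    rw [flow_coordField hij, hf, LinearMap.transvection.apply]
    simp [smul_smul, mul_comm]
  rw [hcoe]
  refine ⟨f.continuous_of_finiteDimensional.measurable, ?_⟩
  rw [Measure.map_linearMap_addHaar_eq_smul_addHaar volume (by rw [hdet]; exact one_ne_zero), hdet]
  simp

theorem inner_coordField_sub (i j : Fin 3) (r : R3) :
    inner ℝ r ((coordField i j - coordField j i) r) = 0 := by
  simp only [sub_apply, coordField_apply, inner_sub_right, inner_smul_right,
    EuclideanSpace.inner_single_right]
  simp [mul_comm]

end VolumePreserving

/-! ### The operators `r_i ∂_{r_j}` and the angular momentum -/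

section Operators

theorem smulLeftCLM_coordFun_lineDerivOp (i j : Fin 3) (φ : 𝓢(R3, ℂ)) :
    SchwartzMap.smulLeftCLM ℂ (coordFun i) (∂_{(EuclideanSpace.single j (1 : ℝ) : R3)} φ) =
      fieldDeriv (coordField i j) φ := by
  ext r
  rw [SchwartzMap.smulLeftCLM_apply_apply (coordFun_hasTemperateGrowth i),
    SchwartzMap.lineDerivOp_apply_eq_fderiv, fieldDeriv_apply, coordField_apply, map_smul]
  simp [coordFun]

/-- For `i ≠ j` the factor `r_i` commutes with `∂_{r_j}`. -/
theorem lineDerivOp_smulLeftCLM_coordFun {i j : Fin 3} (hij : i ≠ j) (φ : 𝓢(R3, ℂ)) :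
    ∂_{(EuclideanSpace.single j (1 : ℝ) : R3)} (SchwartzMap.smulLeftCLM ℂ (coordFun i) φ) =
      fieldDeriv (coordField i j) φ := by
  ext r
  have h₁ : HasFDerivAt (coordFun i)
      (Complex.ofRealCLM ∘L (EuclideanSpace.proj i : R3 →L[ℝ] ℝ)) r :=
    (Complex.ofRealCLM ∘L (EuclideanSpace.proj i : R3 →L[ℝ] ℝ)).hasFDerivAt
  have h₂ := h₁.mul (φ.hasFDerivAt r)
  have h₃ : ⇑(SchwartzMap.smulLeftCLM ℂ (coordFun i) φ) = coordFun i * φ := by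
    ext r
    exact SchwartzMap.smulLeftCLM_apply_apply (coordFun_hasTemperateGrowth i) φ r
  rw [SchwartzMap.lineDerivOp_apply_eq_fderiv, h₃, h₂.fderiv, fieldDeriv_apply, coordField_apply,
    map_smul]
  simp [coordFun, hij]

theorem toDistribution_toLp (φ : 𝓢(R3, ℂ)) :
    L2R3.toDistribution (φ.toLp 2) = SchwartzMap.toTemperedDistributionCLM R3 ℂ volume φ :=
  Lp.toTemperedDistribution_toLp_eq φ

theorem partialDist_toLp (j : Fin 3) (φ : 𝓢(R3, ℂ)) :
    partialDist j (φ.toLp 2) = L2R3.toDistribution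
      ((∂_{(EuclideanSpace.single j (1 : ℝ) : R3)} φ).toLp 2) := by
  rw [toDistribution_toLp, ← TemperedDistribution.lineDerivOp_toTemperedDistributionCLM_eq,
    ← toDistribution_toLp]
  rfl

theorem smulLeftCLM_toDistribution_toLp (i : Fin 3) (φ : 𝓢(R3, ℂ)) :
    TemperedDistribution.smulLeftCLM ℂ (coordFun i) (L2R3.toDistribution (φ.toLp 2)) =
      L2R3.toDistribution ((SchwartzMap.smulLeftCLM ℂ (coordFun i) φ).toLp 2) := by
  ext ψ
  rw [TemperedDistribution.smulLeftCLM_apply_apply, toDistribution_apply, toDistribution_apply]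
  refine integral_congr_ae ?_
  filter_upwards [φ.coeFn_toLp 2 volume,
    (SchwartzMap.smulLeftCLM ℂ (coordFun i) φ).coeFn_toLp 2 volume] with r h₁ h₂
  rw [h₁, h₂]
  simp only [SchwartzMap.smulLeftCLM_apply_apply (coordFun_hasTemperateGrowth i), smul_eq_mul]
  ring

theorem coordPartialDist_toLp (i j : Fin 3) (φ : 𝓢(R3, ℂ)) :
    coordPartialDist i j (φ.toLp 2) =
      L2R3.toDistribution ((fieldDeriv (coordField i j) φ).toLp 2) := by
  rw [← smulLeftCLM_coordFun_lineDerivOp, ← smulLeftCLM_toDistribution_toLp, ← partialDist_toLp]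
  rfl

theorem isLinearTransport_coordPartialDist {i j : Fin 3} (hij : i ≠ j) :
    IsLinearTransport (coordPartialDist i j) (coordField i j) where
  apply u φ := by
    rw [← lineDerivOp_smulLeftCLM_coordFun hij, ← map_neg]
    rfl
  toLp := coordPartialDist_toLp i j

namespace IsLinearTransport

variable {D D' : L2R3 →ₗ[ℂ] 𝓢'(R3, ℂ)} {M M' : R3 →L[ℝ] R3}

theorem sub (hD : IsLinearTransport D M) (hD' : IsLinearTransport D' M') :
    IsLinearTransport (D - D') (M - M') := by
  have h : ∀ φ, fieldDeriv (M - M') φ = fieldDeriv M φ - fieldDeriv M' φ := fun φ => by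
    ext r; simp
  refine ⟨fun u φ => ?_, fun φ => ?_⟩
  · rw [h, map_sub]
    change D u φ - D' u φ = _
    rw [hD.apply, hD'.apply]
    ring
  · rw [h, LinearMap.sub_apply, hD.toLp, hD'.toLp, ← map_sub]
    exact congrArg _ (map_sub (SchwartzMap.toLpCLM ℂ ℂ 2 volume) _ _).symm

theorem smul (hD : IsLinearTransport D M) (c : ℝ) :
    IsLinearTransport ((c : ℂ) • D) (c • M) := by
  have h : ∀ φ, fieldDeriv (c • M) φ = (c : ℂ) • fieldDeriv M φ := fun φ => by
    ext r; simp
  refine ⟨fun u φ => ?_, fun φ => ?_⟩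
  · rw [h, map_smul]
    change (c : ℂ) • D u φ = _
    rw [hD.apply, smul_neg]
  · rw [h, LinearMap.smul_apply, hD.toLp, ← map_smul]
    exact congrArg _ (map_smul (SchwartzMap.toLpCLM ℂ ℂ 2 volume) _ _).symm

end IsLinearTransport

theorem smul_realization {c : ℂ} (hc : c ≠ 0) (D : L2R3 →ₗ[ℂ] 𝓢'(R3, ℂ)) :
    c • realization D = realization (c • D) := by
  refine LinearPMap.eq_of_eq_graph ?_
  ext ⟨u, v⟩
  have h : (u, v) ∈ (c • realization D).graph ↔ (u, c⁻¹ • v) ∈ (realization D).graph := by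
    simp only [LinearPMap.mem_graph_iff, LinearPMap.smul_apply]
    exact exists_congr fun y => and_congr_right fun _ => (eq_inv_smul_iff₀ hc).symm
  rw [h, mem_graph_realization_iff, mem_graph_realization_iff, map_smul, LinearMap.smul_apply,
    eq_inv_smul_iff₀ hc]

theorem toLp_mem_weightedH1 (φ : 𝓢(R3, ℂ)) : (φ.toLp 2 : L2R3) ∈ weightedH1 := by
  refine ⟨?_, fun i j => ⟨_, (coordPartialDist_toLp i j φ).symm⟩⟩
  rw [toDistribution_toLp]
  exact φ.memSobolev

theorem weightedH1_le_domain_coordPartial (i j : Fin 3) : weightedH1 ≤ (coordPartial i j).domain :=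
  fun _ hu => hu.2 i j

theorem weightedH1_le_domain_crossNabla (k : Fin 3) : weightedH1 ≤ (crossNabla k).domain :=
  fun _ hu => (LinearMap.range L2R3.toDistribution).sub_mem (hu.2 (k + 1) (k + 2))
    (hu.2 (k + 2) (k + 1))

/-- A sign only rescales the vector field, so the unsigned operator decides. -/
theorem generator_and_core_smul_realization {D : L2R3 →ₗ[ℂ] 𝓢'(R3, ℂ)} {M : R3 →L[ℝ] R3}
    (hM : ∀ t, MeasurePreserving (flow M t)) (hD : IsLinearTransport D M)
    (hS : weightedH1 ≤ (realization D).domain) {s : ℂ} (hs : s = 1 ∨ s = -1) :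
    IsInfinitesimalGenerator (s • realization D) ∧ (s • realization D).HasCore weightedH1 := by
  obtain ⟨c, hc, rfl⟩ : ∃ c : ℝ, c ≠ 0 ∧ s = c := by
    rcases hs with rfl | rfl
    · exact ⟨1, by simp⟩
    · exact ⟨-1, by simp⟩
  have hdom : weightedH1 ≤ ((c : ℂ) • realization D).domain := hS
  rw [smul_realization (Complex.ofReal_ne_zero.mpr hc)] at hdom ⊢
  have hM' := measurePreserving_flow_smul hM c
  exact ⟨isInfinitesimalGenerator_realization hM' (hD.smul c),
    hasCore_realization hM' (hD.smul c) hdom toLp_mem_weightedH1⟩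

/-- The factors `i / ħ` and `-i ħ` cancel, and a nonzero scalar does not change the domain. -/
theorem smul_angularMomentum {ħ : ℝ} (hħ : ħ ≠ 0) (k : Fin 3) {s : ℂ} (hs : s ≠ 0) :
    (s * Complex.I / (ħ : ℂ)) • angularMomentum ħ k = s • crossNabla k := by
  have hħ' : (ħ : ℂ) ≠ 0 := Complex.ofReal_ne_zero.mpr hħ
  rw [angularMomentum, crossNabla, smul_realization hs, smul_realization
    (div_ne_zero (mul_ne_zero hs Complex.I_ne_zero) hħ'), smul_smul]
  congr 2
  field_simp
  simp

end Operators

theorem mainTheorem4 :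
    (∀ i j : Fin 3, i ≠ j → ∀ s : ℂ, s = 1 ∨ s = -1 →
      IsInfinitesimalGenerator (s • coordPartial i j) ∧
      (s • coordPartial i j).HasCore weightedH1) ∧
    (∀ ħ : ℝ, ħ ≠ 0 → ∀ k : Fin 3, ∀ s : ℂ, s = 1 ∨ s = -1 →
      (s * Complex.I / (ħ : ℂ)) • angularMomentum ħ k = s • crossNabla k ∧
      IsInfinitesimalGenerator ((s * Complex.I / (ħ : ℂ)) • angularMomentum ħ k) ∧
      ((s * Complex.I / (ħ : ℂ)) • angularMomentum ħ k).HasCore weightedH1) := by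
  refine ⟨fun i j hij s hs => ?_, fun ħ hħ k s hs => ?_⟩
  · exact generator_and_core_smul_realization (measurePreserving_flow_coordField hij)
      (isLinearTransport_coordPartialDist hij) (weightedH1_le_domain_coordPartial i j) hs
  · -- The operator `k` is `r_a ∂_b - r_b ∂_a` with the distinct indices `a = k + 1`, `b = k + 2`.
    have hs0 : s ≠ 0 := by rcases hs with rfl | rfl <;> simp
    have hk : k + 1 ≠ k + 2 := by revert k; decide
    rw [smul_angularMomentum hħ k hs0]
    exact ⟨rfl, generator_and_core_smul_realization
      (measurePreserving_flow_of_inner_eq_zero (inner_coordField_sub (k + 1) (k + 2)))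
      ((isLinearTransport_coordPartialDist hk).sub (isLinearTransport_coordPartialDist hk.symm))
      (weightedH1_le_domain_crossNabla k) hs⟩
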